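/- Let $n\ge 1$, $1\le m\le n$ and $N>2$ be integers, let $g:\mathbb R\times\mathbb R\to\mathbb R$ be continuous, and consider the boundary value problem $$y(t+n)+a_{n-1}(t)y(t+n-1)+\cdots+a_0(t)y(t)=g(t,y(t+m-1)),\qquad t=0,\dots,N-1, \tag{1}$$ $$\sum_{k=0}^{N}\sum_{j=1}^n b_{ij}(k)\,y(k+j-1)=0,\qquad i=1,\dots,n, \tag{2}$$ with real coefficients and $a_0(t)\ne 0$ for all $t$. **Notation.** Let $A(t)$ be the $n\times n$ companion matrix with ones on the superdiagonal, last row $(-a_0(t),\dots,-a_{n-1}(t))$ and zeros elsewhere. Put $\Phi(0)=I$ and $\Phi(t)=A(t-1)\cdots A(0)$, let $B_k=(b_{ij}(k))$, and let $D=\sum_{k=0}^N B_k\Phi(k)$. Assume that the boundary conditions are independent, i.e. $[B_0,\dots,B_N]$ has full row rank. Let $X=\{x:\{0,\dots,N\}\to\mathbb R^n : \sum_{k=0}^N B_kx(k)=0\}$ and $Z=\{h:\{0,\dots,N-1\}\to\mathbb R^n\}$, both with the supremum norm built on the Euclidean norm $|\cdot|$ of $\mathbb R^n$, and let $\mathcal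 L:X\to Z$, $(\mathcal Lx)(t)=x(t+1)-A(t)x(t)$. Assume $\dim\operatorname{Ker}\mathcal L=1$, i.e. the linear homogeneous problem has a one-dimensional solution space. Let $u$ and $w$ be basis vectors of $\operatorname{Ker}D$ and $\operatorname{Ker}D^T$, and put $$S(t)=\Phi(t)u,\qquad \Psi^T(t)=\sum_{i=t+1}^{N}w^TB_i\Phi(i)\Phi^{-1}(t+1).$$ Let $V$ be the orthogonal projection of $\mathbb R^n$ onto $\operatorname{Ker}D$, let $P:X\to X$, $[Px](t)=\Phi(t)Vx(0)$, and let $Q:Z\to Z$, $[Qh](t)=\Psi(t)\big(\sum_{j=0}^{N-1}|\Psi(j)|^2\big)^{-1}\sum_{i=0}^{N-1}\Psi^T(i)h(i)$; then $P$ and $I-Q$ are projections onto $\operatorname{Ker}\mathcal L$ and $\operatorname{Im}\mathcal L$. Let $M_p:\operatorname{Im}\mathcal L\to\operatorname{Ker}P$ be the inverse of $\mathcal L|_{\operatorname{Ker}P}$, and let $A=\|M_p(I-Q)\|$ be the operator norm of $M_p(I-Q):Z\to X$. Write $[e]_k$ for the $k$-th coordinate of $e\in\mathbb R^n$, and let $$\mathcal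 O=\{t\in\{0,\dots,N-1\}: [\Psi(t)]_n\ne0,\ [S(t)]_m\neq 0\},\qquad \mathcal O_0=\{t\in\{0,\dots,N-1\}: [\Psi(t)]_n\neq0,\ [S(t)]_m=0\}.$$ Assume that $\mathcal O$ is nonempty and put $$s_{\max}=\max_{0\le t\le N-1}|[S(t)]_m|,\qquad s_{\min}=\min_{t\in\mathcal O}|[S(t)]_m|,\qquad \|g\|_r=\sup_{t\in\{0,\dots,N-1\},\,x\in[-r,r]}|g(t,x)|.$$ **Statement.** Suppose that 1. $\mathcal O_0$ is empty; 2. either $[\Psi(i)]_n[S(i)]_m\ge0$ for all $i=0,\dots,N-1$, or $[\Psi(i)]_n[S(i)]_m\le0$ for all $i=0,\dots,N-1$; 3. there are real numbers $0<c<d$ such that either $g(t,x)>0$ for all $x\in[c,d]$ and $g(t,x)<0$ for all $x\in[-d,-c]$, for every $t=0,\dots,N-1$; or $g(t,x)<0$ for all $x\in[c,d]$ and $g(t,x)>0$ for all $x\in[-d,-c]$, for every $t=0,\dots,N-1$; 4. for these $c$ and $d$, $$d>\frac{c\,s_{\max}+A\,\|g\|_d\,(s_{\max}+s_{\min})}{s_{\min}}.$$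 Then the boundary value problem (1)–(2) has a solution. -/

import Mathlib

noncomputable section

namespace MultipointBVP

open Matrix

/-- `ℝⁿ` with the Euclidean norm `|·|`. -/
abbrev E (n : ℕ) : Type := EuclideanSpace ℝ (Fin n)

/-- The action of an `n × n` matrix on column vectors. -/
abbrev act {n : ℕ} (M : Matrix (Fin n) (Fin n) ℝ) : E n →ₗ[ℝ] E n := Matrix.toEuclideanLin M

/-- The last coordinate of `ℝⁿ` (coordinates are counted from `0`). -/
def lastIdx (n : ℕ) [NeZero n] : Fin n := ⟨n - 1, Nat.sub_one_lt (NeZero.ne n)⟩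

/-- The companion matrix `A(t)`: ones above the diagonal, last row `-a₀(t), …, -aₙ₋₁(t)`. -/
def companion {n : ℕ} (a : ℕ → Fin n → ℝ) (t : ℕ) : Matrix (Fin n) (Fin n) ℝ :=
  Matrix.of fun i j =>
    if i.val + 1 = n then - a t j else if j.val = i.val + 1 then 1 else 0

/-- The principal fundamental matrix `Φ(t) = A(t-1) ⋯ A(0)`, `Φ(0) = I`. -/
def fundamental {n : ℕ} (a : ℕ → Fin n → ℝ) : ℕ → Matrix (Fin n) (Fin n) ℝ
  | 0 => 1
  | t + 1 => companion a t * fundamental a t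

/-- The matrix `∑_{k=0}^N B_k Φ(k)`. -/
def boundaryMatrix {n : ℕ} (N : ℕ) (a : ℕ → Fin n → ℝ) (B : ℕ → Matrix (Fin n) (Fin n) ℝ) :
    Matrix (Fin n) (Fin n) ℝ :=
  ∑ k ∈ Finset.range (N + 1), B k * fundamental a k

/-- The space `X` of functions `{0, …, N} → ℝⁿ` that satisfy the boundary conditions
`∑_{k=0}^N B_k x(k) = 0`; it carries the supremum norm. -/
def spaceX {n : ℕ} (N : ℕ) (B : ℕ → Matrix (Fin n) (Fin n) ℝ) :
    Submodule ℝ (Fin (N + 1) → E n) where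
  carrier := {x | ∑ k : Fin (N + 1), act (B k) (x k) = 0}
  add_mem' := by
    intro x y hx hy
    change _ = _ at hx hy ⊢
    simp only [Pi.add_apply, map_add, Finset.sum_add_distrib, hx, hy, add_zero]
  zero_mem' := by simp
  smul_mem' := by
    intro c x hx
    change _ = _ at hx ⊢
    simp only [Pi.smul_apply, map_smul, ← Finset.smul_sum, hx, smul_zero]

/-- The space `Z` of functions `{0, …, N-1} → ℝⁿ`; it carries the supremum norm. -/
abbrev spaceZ (n N : ℕ) : Type := Fin N → E n

/-- The operator `ℒ : X → Z`, `(ℒx)(t) = x(t+1) - A(t)x(t)`. Its kernel is the solution space of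
the linear homogeneous boundary value problem. -/
def opL {n : ℕ} (N : ℕ) (a : ℕ → Fin n → ℝ) (B : ℕ → Matrix (Fin n) (Fin n) ℝ) :
    spaceX N B →ₗ[ℝ] spaceZ n N where
  toFun x := fun t => x.1 t.succ - act (companion a t) (x.1 t.castSucc)
  map_add' := by
    intro x y
    funext t
    simp only [Submodule.coe_add, Pi.add_apply, map_add]
    abel
  map_smul' := by
    intro c x
    funext t
    simp only [Submodule.coe_smul, Pi.smul_apply, map_smul, RingHom.id_apply, smul_sub]

lemma act_mul {n : ℕ} (M M' : Matrix (Fin n) (Fin n) ℝ) (x : E n) :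
    act (M * M') x = act M (act M' x) := by
  simp [act, Matrix.toLpLin_mul_same]

lemma inner_act_transpose {n : ℕ} (M : Matrix (Fin n) (Fin n) ℝ) (x y : E n) :
    inner ℝ (act M.transpose x) y = inner ℝ x (act M y) := by
  rw [← Matrix.conjTranspose_eq_transpose_of_trivial, act,
    Matrix.toEuclideanLin_conjTranspose_eq_adjoint, LinearMap.adjoint_inner_left]

end MultipointBVP

open MultipointBVP in
/-- The linear part of a scalar multipoint boundary value problem of order `n` on `{0, …, N}` at
resonance: the coefficients `a_j(t)` of the difference equation (only `t < N` matters), the matrices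
`B_k = (b_{ij}(k))` of the boundary conditions (only `k ≤ N` matters), the standing assumptions on
them, and basis vectors `u`, `w` of the kernels of `∑ B_k Φ(k)` and of its transpose. -/
structure ResonantBVP (n N : ℕ) [NeZero n] where
  a : ℕ → Fin n → ℝ
  B : ℕ → Matrix (Fin n) (Fin n) ℝ
  /-- `a₀(t) ≠ 0`. -/
  a_zero_ne_zero : ∀ t < N, a t 0 ≠ 0
  /-- The boundary conditions are independent: `[B_0, …, B_N]` has full row rank. -/
  boundary_independent :
    LinearIndependent ℝ (fun (i : Fin n) (kj : Fin (N + 1) × Fin n) => B kj.1 i kj.2)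
  /-- The linear homogeneous problem has a one-dimensional solution space. -/
  finrank_ker : Module.finrank ℝ (LinearMap.ker (opL N a B)) = 1
  u : E n
  u_ne_zero : u ≠ 0
  span_u : Submodule.span ℝ {u} = LinearMap.ker (act (boundaryMatrix N a B))
  w : E n
  w_ne_zero : w ≠ 0
  span_w : Submodule.span ℝ {w} = LinearMap.ker (act (boundaryMatrix N a B).transpose)

namespace ResonantBVP

open Matrix MultipointBVP

variable {n N : ℕ} [NeZero n] (p : ResonantBVP n N)

/-- `S(t) = Φ(t)u`. -/
def S (t : ℕ) : E n := act (fundamental p.a t) p.u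

/-- `Ψ(t)`, the column vector with
`Ψᵀ(t) = ∑_{i=t+1}^N wᵀ B_i Φ(i) Φ⁻¹(t+1)`. -/
def Psi (t : ℕ) : E n :=
  ∑ i ∈ Finset.Icc (t + 1) N,
    act (p.B i * fundamental p.a i * (fundamental p.a (t + 1))⁻¹).transpose p.w

/-- The functional `h ↦ ∑_{i=0}^{N-1} Ψᵀ(i) h(i)` on `Z`. -/
def psiSum : spaceZ n N →ₗ[ℝ] ℝ where
  toFun h := ∑ i : Fin N, inner ℝ (p.Psi i) (h i)
  map_add' := by
    intro x y
    simp only [Pi.add_apply, inner_add_right, Finset.sum_add_distrib]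
  map_smul' := by
    intro c x
    simp only [Pi.smul_apply, inner_smul_right, Finset.mul_sum, RingHom.id_apply, smul_eq_mul]

/-- `Q : Z → Z`, `[Qh](t) = Ψ(t) (∑_j |Ψ(j)|²)⁻¹ ∑_i Ψᵀ(i)h(i)`. -/
def Q : spaceZ n N →ₗ[ℝ] spaceZ n N where
  toFun h := fun t => ((∑ j : Fin N, ‖p.Psi j‖ ^ 2)⁻¹ * p.psiSum h) • p.Psi t
  map_add' := by
    intro x y
    funext t
    simp only [map_add, mul_add, add_smul, Pi.add_apply]
  map_smul' := by
    intro c x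
    funext t
    simp only [map_smul, smul_eq_mul, Pi.smul_apply, RingHom.id_apply, smul_smul]
    congr 1
    ring

/-- The orthogonal projection `V` of `ℝⁿ` onto `Ker(∑ B_k Φ(k))`. -/
def V : E n →L[ℝ] E n :=
  (LinearMap.ker (act (boundaryMatrix N p.a p.B))).starProjection

lemma sum_boundary (ξ : E n) :
    ∑ k : Fin (N + 1), act (p.B k) (act (fundamental p.a k) ξ)
      = act (boundaryMatrix N p.a p.B) ξ := by
  simp only [← act_mul, boundaryMatrix, map_sum, LinearMap.sum_apply]
  rw [Finset.sum_range]

lemma V_mem (ξ : E n) : act (boundaryMatrix N p.a p.B) (p.V ξ) = 0 :=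
  LinearMap.mem_ker.1 (Submodule.starProjection_apply_mem _ ξ)

lemma V_eq_self {ξ : E n} (h : act (boundaryMatrix N p.a p.B) ξ = 0) : p.V ξ = ξ :=
  Submodule.starProjection_eq_self_iff.2 (LinearMap.mem_ker.2 h)

/-- `P : X → X`, `[Px](t) = Φ(t) V x(0)`. -/
def P : spaceX N p.B →ₗ[ℝ] spaceX N p.B where
  toFun x := ⟨fun t => act (fundamental p.a t) (p.V (x.1 0)), by
    change ∑ k : Fin (N + 1), act (p.B k) (act (fundamental p.a k) (p.V (x.1 0))) = 0
    rw [sum_boundary, V_mem]⟩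
  map_add' := by
    intro x y
    ext1
    funext t
    simp only [Submodule.coe_add, Pi.add_apply, map_add]
  map_smul' := by
    intro c x
    ext1
    funext t
    simp only [Submodule.coe_smul, Pi.smul_apply, map_smul, RingHom.id_apply]

/-- The operator `ℒ` of the problem. -/
abbrev L : spaceX N p.B →ₗ[ℝ] spaceZ n N := opL N p.a p.B

lemma P_apply (x : spaceX N p.B) (t : Fin (N + 1)) :
    (p.P x).1 t = act (fundamental p.a t) (p.V (x.1 0)) := rfl

lemma L_apply (x : spaceX N p.B) (t : Fin N) :
    p.L x t = x.1 t.succ - act (companion p.a t) (x.1 t.castSucc) := rfl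

lemma L_P (x : spaceX N p.B) : p.L (p.P x) = 0 := by
  funext t
  rw [L_apply, P_apply, P_apply]
  simp only [Fin.val_succ, Fin.val_castSucc, fundamental, act_mul, sub_self, Pi.zero_apply]

lemma P_eq_self {x : spaceX N p.B} (hx : p.L x = 0) : p.P x = x := by
  have h1 : ∀ (k : ℕ) (hk : k < N + 1), x.1 ⟨k, hk⟩ = act (fundamental p.a k) (x.1 0) := by
    intro k
    induction k with
    | zero => intro _; simp [fundamental, act]
    | succ k ih =>
      intro hk
      have h := congrFun hx ⟨k, by omega⟩
      rw [L_apply] at h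
      have h' := sub_eq_zero.1 h
      simp only [Fin.succ_mk, Fin.castSucc_mk] at h'
      rw [h', ih (by omega), fundamental, act_mul]
  have h0 : act (boundaryMatrix N p.a p.B) (x.1 0) = 0 := by
    rw [← sum_boundary]
    have := x.2
    change ∑ k : Fin (N + 1), act (p.B k) (x.1 k) = 0 at this
    rw [← this]
    exact Finset.sum_congr rfl fun k _ => by rw [← h1 k k.2]
  ext1
  funext t
  rw [P_apply, V_eq_self p h0, ← h1 t t.2]

lemma P_idem (x : spaceX N p.B) : p.P (p.P x) = p.P x := P_eq_self p (L_P p x)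

/-- `ℒ` restricted to `Ker(P)`, as a map onto its image. -/
def LRestr : LinearMap.ker p.P →ₗ[ℝ] LinearMap.range p.L :=
  (p.L.rangeRestrict).domRestrict (LinearMap.ker p.P)

lemma LRestr_bijective : Function.Bijective p.LRestr := by
  constructor
  · rintro ⟨x, hx⟩ ⟨y, hy⟩ h
    have hL : p.L x = p.L y := congrArg Subtype.val h
    have h1 : p.P (x - y) = x - y := P_eq_self p (by rw [map_sub, hL, sub_self])
    rw [map_sub, LinearMap.mem_ker.1 hx, LinearMap.mem_ker.1 hy, sub_self] at h1
    exact Subtype.ext (sub_eq_zero.1 h1.symm)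
  · rintro ⟨_, x, rfl⟩
    refine ⟨⟨x - p.P x, ?_⟩, ?_⟩
    · rw [LinearMap.mem_ker, map_sub, P_idem, sub_self]
    · ext1
      change p.L (x - p.P x) = p.L x
      rw [map_sub, L_P, sub_zero]

/-- `M_p`, the inverse of `ℒ` restricted to `Ker(P)`. -/
def Mp : LinearMap.range p.L →ₗ[ℝ] LinearMap.ker p.P :=
  (LinearEquiv.ofBijective p.LRestr p.LRestr_bijective).symm.toLinearMap

lemma isUnit_companion {t : ℕ} (ht : t < N) : IsUnit (companion p.a t) := by
  rw [← Matrix.mulVec_injective_iff_isUnit]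
  rw [← Matrix.coe_mulVecLin, ← LinearMap.ker_eq_bot, LinearMap.ker_eq_bot']
  intro x hx
  have hrow : ∀ i, ∑ j, companion p.a t i j * x j = 0 := fun i => congrFun hx i
  have hsucc : ∀ j : Fin n, j ≠ 0 → x j = 0 := by
    intro j hj
    have hj' : j.val ≠ 0 := fun h => hj (Fin.ext h)
    have h := hrow ⟨j.val - 1, by omega⟩
    rw [Finset.sum_eq_single j] at h
    · have h1 : ¬ (j.val - 1 + 1 = n) := by omega
      have h2 : j.val = j.val - 1 + 1 := by omega
      simp only [companion, Matrix.of_apply] at h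
      rwa [if_neg h1, if_pos h2, one_mul] at h
    · intro b _ hb
      have h1 : ¬ (j.val - 1 + 1 = n) := by omega
      have h2 : ¬ (b.val = j.val - 1 + 1) := fun h => hb (Fin.ext (by omega))
      simp [companion, h1, h2]
    · simp
  have hzero : x 0 = 0 := by
    have h := hrow (lastIdx n)
    have hn : n - 1 + 1 = n := Nat.sub_add_cancel (Nat.pos_of_ne_zero (NeZero.ne n))
    rw [Finset.sum_eq_single 0] at h
    · simpa [companion, lastIdx, hn, p.a_zero_ne_zero t ht] using h
    · intro b _ hb
      rw [hsucc b hb, mul_zero]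
    · simp
  funext j
  by_cases hj : j = 0
  · rw [hj, hzero, Pi.zero_apply]
  · rw [hsucc j hj, Pi.zero_apply]

lemma isUnit_fundamental {t : ℕ} (ht : t ≤ N) : IsUnit (fundamental p.a t) := by
  induction t with
  | zero => exact isUnit_one
  | succ t ih => exact (p.isUnit_companion (by omega)).mul (ih (by omega))

lemma fundamental_mul_inv {t : ℕ} (ht : t ≤ N) :
    fundamental p.a t * (fundamental p.a t)⁻¹ = 1 :=
  Matrix.mul_nonsing_inv _ ((Matrix.isUnit_iff_isUnit_det _).1 (p.isUnit_fundamental ht))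

lemma psiSum_apply (h : ℕ → E n) :
    p.psiSum (fun i => h i) = ∑ i ∈ Finset.range N, inner ℝ (p.Psi i) (h i) := by
  rw [Finset.sum_range]
  rfl

/-- The solution of `y(t+1) = A(t)y(t) + h(t)`, `y(0) = 0`. -/
def particular (h : ℕ → E n) : ℕ → E n
  | 0 => 0
  | t + 1 => act (companion p.a t) (particular h t) + h t

lemma particular_eq (h : ℕ → E n) {t : ℕ} (ht : t ≤ N) :
    p.particular h t = ∑ i ∈ Finset.range t,
      act (fundamental p.a t * (fundamental p.a (i + 1))⁻¹) (h i) := by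
  induction t with
  | zero => simp [particular]
  | succ t ih =>
    rw [Finset.sum_range_succ, p.fundamental_mul_inv ht, particular, ih (by omega), map_sum]
    congr 1
    · refine Finset.sum_congr rfl fun i _ => ?_
      rw [← act_mul, ← Matrix.mul_assoc]
      rfl
    · simp [act]

lemma inner_particular (h : ℕ → E n) :
    inner ℝ p.w (∑ k ∈ Finset.range (N + 1), act (p.B k) (p.particular h k))
      = p.psiSum (fun i => h i) := by
  rw [psiSum_apply, inner_sum]
  have h1 : ∀ k ∈ Finset.range (N + 1), inner ℝ p.w (act (p.B k) (p.particular h k))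
      = ∑ i ∈ Finset.range k, inner ℝ
        (act (p.B k * fundamental p.a k * (fundamental p.a (i + 1))⁻¹).transpose p.w) (h i) := by
    intro k hk
    rw [p.particular_eq h (by simpa [Nat.lt_succ_iff] using hk), map_sum, inner_sum]
    refine Finset.sum_congr rfl fun i _ => ?_
    rw [inner_act_transpose, ← act_mul, Matrix.mul_assoc]
  rw [Finset.sum_congr rfl h1]
  simp only [Psi, sum_inner]
  refine Finset.sum_comm' ?_
  intro k i
  simp only [Finset.mem_range, Finset.mem_Icc]
  omega

lemma mem_range_boundary {z : E n} (hz : inner ℝ p.w z = 0) :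
    ∃ ξ, act (boundaryMatrix N p.a p.B) ξ = z := by
  set T := act (boundaryMatrix N p.a p.B) with hT
  have hmem : z ∈ (LinearMap.range T)ᗮᗮ := by
    rw [Submodule.mem_orthogonal]
    intro v hv
    have hv' : v ∈ Submodule.span ℝ {p.w} := by
      rw [p.span_w, LinearMap.mem_ker]
      refine ext_inner_right ℝ fun y => ?_
      rw [inner_act_transpose, inner_zero_left]
      exact Submodule.inner_left_of_mem_orthogonal (LinearMap.mem_range_self T y) hv
    obtain ⟨c, rfl⟩ := Submodule.mem_span_singleton.1 hv'
    rw [inner_smul_left, hz, mul_zero]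
  rw [Submodule.orthogonal_orthogonal] at hmem
  exact hmem

lemma mem_range_L {h : spaceZ n N} (hh : p.psiSum h = 0) : h ∈ LinearMap.range p.L := by
  classical
  let H : ℕ → E n := fun i => if hi : i < N then h ⟨i, hi⟩ else 0
  have hH : (fun i : Fin N => H i) = h := by
    funext i
    simp [H]
  have h0 := p.inner_particular H
  rw [hH, hh] at h0
  obtain ⟨ξ, hξ⟩ := p.mem_range_boundary h0
  refine ⟨⟨fun k => p.particular H k - act (fundamental p.a k) ξ, ?_⟩, ?_⟩
  · change ∑ k : Fin (N + 1), act (p.B k) (p.particular H k - act (fundamental p.a k) ξ) = 0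
    simp only [map_sub, Finset.sum_sub_distrib]
    rw [sum_boundary, hξ, Finset.sum_range, sub_self]
  · funext t
    rw [L_apply]
    simp only [Fin.val_succ, Fin.val_castSucc, particular, fundamental, act_mul, map_sub]
    rw [← congrFun hH t]
    abel

lemma exists_Psi_ne_zero : ∃ t : Fin N, p.Psi t ≠ 0 := by
  by_contra! hcon
  have hall : ∀ h : ℕ → E n, p.psiSum (fun i => h i) = 0 := by
    intro h
    change ∑ i : Fin N, inner ℝ (p.Psi i) (h i) = 0
    exact Finset.sum_eq_zero fun i _ => by rw [hcon i, inner_zero_left]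
  -- A function `z` on `{0, …, N}` with `z(0) = 0` is the solution for a suitable right-hand side.
  have hpart : ∀ z : ℕ → E n, z 0 = 0 →
      p.particular (fun t => z (t + 1) - act (companion p.a t) (z t)) = z := by
    intro z hz
    funext t
    induction t with
    | zero => rw [particular, hz]
    | succ t ih => rw [particular, ih]; abel
  have hB0 : ∀ z : ℕ → E n, z 0 = 0 →
      inner ℝ p.w (∑ k ∈ Finset.range (N + 1), act (p.B k) (z k)) = 0 := by
    intro z hz
    have h1 := p.inner_particular (fun t => z (t + 1) - act (companion p.a t) (z t))
    have h2 := hall (fun t => z (t + 1) - act (companion p.a t) (z t))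
    have h3 := h1.trans h2
    rwa [hpart z hz] at h3
  have hM : ∀ ξ, inner ℝ p.w (act (boundaryMatrix N p.a p.B) ξ) = 0 := by
    intro ξ
    have hw : p.w ∈ LinearMap.ker (act (boundaryMatrix N p.a p.B).transpose) := by
      rw [← p.span_w]
      exact Submodule.mem_span_singleton_self _
    rw [← inner_act_transpose, LinearMap.mem_ker.1 hw, inner_zero_left]
  have hB : ∀ z : ℕ → E n,
      inner ℝ p.w (∑ k ∈ Finset.range (N + 1), act (p.B k) (z k)) = 0 := by
    intro z
    have h1 := hB0 (fun k => z k - act (fundamental p.a k) (z 0)) (by simp [fundamental, act])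
    have h2 := hM (z 0)
    rw [← sum_boundary, ← Finset.sum_range fun k => act (p.B k) (act (fundamental p.a k) (z 0))]
      at h2
    simpa only [map_sub, Finset.sum_sub_distrib, inner_sub_right, h2, sub_zero] using h1
  have hrow : ∀ k < N + 1, ∀ y : E n, inner ℝ p.w (act (p.B k) y) = 0 := by
    intro k hk y
    have h1 := hB (fun i => if i = k then y else 0)
    rwa [Finset.sum_eq_single k, if_pos rfl] at h1
    · intro b _ hb
      rw [if_neg hb, map_zero]
    · intro hk'
      exact absurd (Finset.mem_range.2 hk) hk'
  refine p.w_ne_zero ?_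
  have hli := Fintype.linearIndependent_iff.1 p.boundary_independent (fun i => p.w i) ?_
  · ext i
    exact hli i
  · funext kj
    have h1 := hrow kj.1 kj.1.2 (EuclideanSpace.single kj.2 1)
    simpa [PiLp.inner_apply, act, Matrix.toLpLin_apply, mul_comm] using h1

lemma psiSum_Q (h : spaceZ n N) : p.psiSum (p.Q h) = p.psiSum h := by
  have hne : (∑ j : Fin N, ‖p.Psi j‖ ^ 2) ≠ 0 := by
    obtain ⟨t, ht⟩ := p.exists_Psi_ne_zero
    refine ne_of_gt (Finset.sum_pos' (fun i _ => by positivity) ⟨t, Finset.mem_univ _, ?_⟩)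
    have := norm_pos_iff.2 ht
    positivity
  change ∑ i : Fin N, inner ℝ (p.Psi i)
    (((∑ j : Fin N, ‖p.Psi j‖ ^ 2)⁻¹ * p.psiSum h) • p.Psi i) = _
  simp only [inner_smul_right, real_inner_self_eq_norm_sq, ← Finset.mul_sum]
  field_simp

/-- `I - Q`, as a map `Z → Im(ℒ)`. -/
def oneSubQ : spaceZ n N →ₗ[ℝ] LinearMap.range p.L :=
  LinearMap.codRestrict _ (LinearMap.id - p.Q) fun h => p.mem_range_L (by
    rw [LinearMap.sub_apply, map_sub, psiSum_Q, LinearMap.id_apply, sub_self])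

/-- The operator `M_p(I - Q) : Z → X`. -/
def MpOneSubQ : spaceZ n N →ₗ[ℝ] spaceX N p.B :=
  (LinearMap.ker p.P).subtype ∘ₗ p.Mp ∘ₗ p.oneSubQ

/-- `‖M_p(I - Q)‖`, the operator norm for the supremum norms on `Z` and `X`. -/
def opNormA : ℝ := ‖LinearMap.toContinuousLinearMap p.MpOneSubQ‖

/-! The sign sets. The index `m : Fin n` is counted from `0`. -/

/-- `[Ψ(t)]_n > 0`, `[S(t)]_m > 0`. -/
def Opp (m : Fin n) : Set (Fin N) := {t | 0 < p.Psi t (lastIdx n) ∧ 0 < p.S t m}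

/-- `[Ψ(t)]_n > 0`, `[S(t)]_m < 0`. -/
def Opm (m : Fin n) : Set (Fin N) := {t | 0 < p.Psi t (lastIdx n) ∧ p.S t m < 0}

/-- `[Ψ(t)]_n < 0`, `[S(t)]_m > 0`. -/
def Omp (m : Fin n) : Set (Fin N) := {t | p.Psi t (lastIdx n) < 0 ∧ 0 < p.S t m}

/-- `[Ψ(t)]_n < 0`, `[S(t)]_m < 0`. -/
def Omm (m : Fin n) : Set (Fin N) := {t | p.Psi t (lastIdx n) < 0 ∧ p.S t m < 0}

/-- `[Ψ(t)]_n ≠ 0`, `[S(t)]_m = 0`. -/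
def Ozero (m : Fin n) : Set (Fin N) := {t | p.Psi t (lastIdx n) ≠ 0 ∧ p.S t m = 0}

/-- The union of the four sign sets. -/
def O (m : Fin n) : Set (Fin N) := p.Opp m ∪ p.Opm m ∪ p.Omp m ∪ p.Omm m

/-- `s_max`, the maximum of `|[S(t)]_m|` over `{0, …, N-1}`. -/
def smax (m : Fin n) : ℝ := sSup (Set.range fun t : Fin N => |p.S t m|)

/-- `s_min`, the minimum of `|[S(t)]_m|` over the set `O` (used only where `O` is nonempty). -/
def smin (m : Fin n) : ℝ := sInf ((fun t : Fin N => |p.S t m|) '' p.O m)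

end ResonantBVP

/-- `‖g‖_r`, the supremum of `|g(t,x)|` over `t ∈ {0, …, N-1}` and `x ∈ [-r, r]`. -/
def supNormOn (N : ℕ) (g : ℝ × ℝ → ℝ) (r : ℝ) : ℝ :=
  sSup {v | ∃ t < N, ∃ x ∈ Set.Icc (-r) r, v = |g ((t : ℝ), x)|}

end

/-! The proof is a Lyapunov–Schmidt reduction closed by Brouwer's theorem. Write x = αS + v. Since
`L` kills S and inverts `MpOneSubQ` up to `Q`, x solves the system as soon as v = M_p(I - Q)F(x) and
the scalar equation ∑ Ψᵀ(t)F(x)(t) = 0 holds, where F(x)(t) is g(t, [x(t)]_m) times the last unit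
vector. Truncating the argument of g to [-d, d] bounds v by R = A‖g‖_d. For α = ±r with r = (c +
R)/s_min, the argument α[S(t)]_m + [v(t)]_m on O has the sign of α[S(t)]_m and modulus between c and
d; the upper bound is the growth condition. By the sign hypotheses all nonzero terms of the scalar
equation then agree in sign, and the sign flips between r and -r. `exists_zero_and_fixedPoint`
solves both equations at once with |α| ≤ r, where the truncation is inactive.
`exists_scalar_solution` returns from the system to the scalar problem. Brouwer's theorem is proved
analytically: a change of variables identity, valid for id - sf with s small, is polynomial in s and
hence holds at s = 1. -/

/-! ### Brouwer's fixed point theorem by change of variables. -/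

section Brouwer

open MeasureTheory Metric Set Filter Topology Polynomial

/-- If `h x s` is a polynomial in `s` of bounded degree for each `x`, and `∫ h x s` is constant for
`s` in a nontrivial interval, then it is constant. -/
lemma integral_eq_of_polynomial_of_eqOn {α : Type*} [MeasurableSpace α] {μ : Measure α}
    (h : α → ℝ → ℝ) (D : ℕ) {ε c : ℝ} (hε : 0 < ε)
    (hpoly : ∀ x, ∃ q : ℝ[X], q.natDegree ≤ D ∧ ∀ s, q.eval s = h x s)
    (hInt : ∀ s ∈ Icc 0 ε, Integrable (fun x => h x s) μ)
    (hc : ∀ s ∈ Icc 0 ε, ∫ x, h x s ∂μ = c) (s : ℝ) :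
    ∫ x, h x s ∂μ = c := by
  let v : ℕ → ℝ := fun i => ε * (i / (D + 1))
  have hv : Set.InjOn v (Finset.range (D + 1)) := by
    intro i _ j _ hij
    have hD : (D + 1 : ℝ) ≠ 0 := by positivity
    have := mul_left_cancel₀ hε.ne' hij
    rw [div_left_inj' hD] at this
    exact_mod_cast this
  have hmem : ∀ i ∈ Finset.range (D + 1), v i ∈ Icc 0 ε := by
    intro i hi
    have hi' : (i : ℝ) ≤ D + 1 := by
      have := (Finset.mem_range.1 hi).le
      exact_mod_cast this
    refine ⟨by positivity, ?_⟩
    have : (i : ℝ) / (D + 1) ≤ 1 := by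
      rw [div_le_one (by positivity)]; exact hi'
    calc v i ≤ ε * 1 := mul_le_mul_of_nonneg_left this hε.le
      _ = ε := mul_one ε
  -- The Lagrange weights depend on s but not on q, so they pass through the integral; no regularity
  -- in x of the coefficients of q is needed.
  have key : ∀ q : ℝ[X], q.natDegree ≤ D → q.eval s = ∑ i ∈ Finset.range (D + 1),
      q.eval (v i) * (Lagrange.basis (Finset.range (D + 1)) v i).eval s := by
    intro q hq
    have hdeg : q.degree < (Finset.range (D + 1)).card := by
      rw [Finset.card_range]
      exact (Polynomial.degree_le_of_natDegree_le hq).trans_lt (by exact_mod_cast Nat.lt_succ_self D)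
    conv_lhs => rw [Lagrange.eq_interpolate hv hdeg]
    simp [Lagrange.interpolate_apply, Polynomial.eval_finsetSum]
  have h1 : ∀ x, h x s = ∑ i ∈ Finset.range (D + 1),
      h x (v i) * (Lagrange.basis (Finset.range (D + 1)) v i).eval s := by
    intro x
    obtain ⟨q, hq, hqe⟩ := hpoly x
    simpa only [hqe] using key q hq
  -- Applied to a constant polynomial, the interpolation formula expresses c with the same weights.
  have h2 := key (C c) (by simp)
  simp only [eval_C] at h2
  simp only [h1]
  rw [integral_finsetSum _ fun i hi => (hInt _ (hmem i hi)).mul_const _, h2]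
  refine Finset.sum_congr rfl fun i hi => ?_
  rw [integral_mul_const, hc _ (hmem i hi)]

variable {E : Type*} [NormedAddCommGroup E]

lemma exists_polynomial_det_one_sub_smul [NormedSpace ℝ E] [FiniteDimensional ℝ E] (M : E →L[ℝ] E) :
    ∃ q : ℝ[X], q.natDegree ≤ Module.finrank ℝ E ∧
      ∀ s : ℝ, q.eval s = (ContinuousLinearMap.id ℝ E - s • M).det := by
  classical
  let b := Module.finBasis ℝ E
  let A := LinearMap.toMatrix b b (M : E →ₗ[ℝ] E)
  refine ⟨Matrix.det ((X : ℝ[X]) • (-A).map C + (1 : Matrix _ _ ℝ).map C), ?_, fun s => ?_⟩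
  · simpa using Polynomial.natDegree_det_X_add_C_le (-A) 1
  · rw [← coe_evalRingHom, RingHom.map_det, ContinuousLinearMap.det, ← LinearMap.det_toMatrix b]
    congr 1
    ext i j
    simp [A, Matrix.one_apply, apply_ite, LinearMap.toMatrix_apply, Finsupp.single_apply, eq_comm]
    split_ifs <;> ring

/-- Along the segment id - sM, 0 ≤ s ≤ 1, the determinant starts at 1 and never vanishes, because v
= sMv forces v = 0. -/
lemma det_one_sub_pos [NormedSpace ℝ E] [FiniteDimensional ℝ E] (M : E →L[ℝ] E) (hM : ‖M‖ < 1) :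
    0 < (ContinuousLinearMap.id ℝ E - M).det := by
  obtain ⟨q, -, hq⟩ := exists_polynomial_det_one_sub_smul M
  have hne : ∀ s ∈ Icc (0 : ℝ) 1, q.eval s ≠ 0 := by
    intro s hs h0
    rw [hq] at h0
    obtain ⟨v, hv, hv0⟩ := Submodule.exists_mem_ne_zero_of_ne_bot
      (LinearMap.bot_lt_ker_of_det_eq_zero h0).ne'
    have hv' : v = s • M v := sub_eq_zero.1 hv
    have h1 : ‖v‖ ≤ ‖M‖ * ‖v‖ := by
      calc ‖v‖ = ‖s • M v‖ := congrArg _ hv'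
        _ = s * ‖M v‖ := by rw [norm_smul, Real.norm_of_nonneg hs.1]
        _ ≤ 1 * ‖M v‖ := mul_le_mul_of_nonneg_right hs.2 (norm_nonneg _)
        _ ≤ ‖M‖ * ‖v‖ := by rw [one_mul]; exact M.le_opNorm v
    have := norm_pos_iff.2 hv0
    nlinarith
  have h0 : q.eval 0 = 1 := by
    rw [hq, zero_smul, sub_zero]
    exact LinearMap.det_id
  have h1 : (ContinuousLinearMap.id ℝ E - M).det = q.eval 1 := by rw [hq, one_smul]
  rw [h1]
  by_contra! hle
  obtain ⟨s, hs, hs0⟩ := intermediate_value_Icc' zero_le_one q.continuous.continuousOn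
    (show (0 : ℝ) ∈ Icc (q.eval 1) (q.eval 0) from ⟨hle, by rw [h0]; exact zero_le_one⟩)
  exact hne s hs hs0

/-- A contractive perturbation of the identity is injective, and the preimage of y is the fixed
point of x ↦ y + f x. Outside the ball the map is the identity, so injectivity prevents points from
crossing the boundary either way. -/
lemma bijOn_closedBall_id_sub [CompleteSpace E] {f : E → E} {K : NNReal} (hK : K < 1)
    (hf : LipschitzWith K f) {ρ : ℝ} (hsupp : ∀ x, x ∉ closedBall 0 ρ → f x = 0) :
    BijOn (fun x => x - f x) (closedBall 0 ρ) (closedBall 0 ρ) := by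
  have hinj : Function.Injective fun x => x - f x := by
    intro x y hxy
    have h1 : x - y = f x - f y := by
      have hxy' : x - f x = y - f y := hxy
      rwa [sub_eq_sub_iff_sub_eq_sub] at hxy'
    have h2 := hf.dist_le_mul x y
    rw [dist_eq_norm, dist_eq_norm, ← h1] at h2
    have h3 : (K : ℝ) < 1 := hK
    have h4 := norm_nonneg (x - y)
    have h5 : ‖x - y‖ = 0 := by nlinarith
    exact sub_eq_zero.1 (norm_eq_zero.1 h5)
  have hfix : ∀ x, x ∉ closedBall 0 ρ → x - f x = x := fun x hx => by rw [hsupp x hx, sub_zero]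
  refine ⟨fun x hx => ?_, hinj.injOn, fun y hy => ?_⟩
  · by_contra hz
    have hz' : x - f x = x := hinj (hfix _ hz)
    exact hz (by simpa only [hz'] using hx)
  · have hc : ContractingWith K fun x => y + f x :=
      ⟨hK, by simpa using (LipschitzWith.const (α := E) y).add hf⟩
    have hx : y + f hc.fixedPoint = hc.fixedPoint := hc.fixedPoint_isFixedPt
    have hxy : hc.fixedPoint - f hc.fixedPoint = y := sub_eq_iff_eq_add.2 hx.symm
    refine ⟨_, ?_, hxy⟩
    by_contra hz
    exact hz (((hfix _ hz).symm.trans hxy).symm ▸ hy)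

/-- Change of variables for a bijection of the ball; `det_one_sub_pos` removes the absolute value,
which is what leaves an expression polynomial in the perturbation. -/
lemma integral_closedBall_eq_integral_det [NormedSpace ℝ E] [FiniteDimensional ℝ E]
    [MeasurableSpace E] [BorelSpace E]
    (μ : Measure E) [μ.IsAddHaarMeasure] {f : E → E} (hf : ContDiff ℝ 1 f) {K : NNReal} (hK : K < 1)
    (hfK : LipschitzWith K f) {ρ : ℝ} (hsupp : ∀ x, x ∉ closedBall 0 ρ → f x = 0) (η : E → ℝ) :
    ∫ x in closedBall 0 ρ, η (x - f x) * (ContinuousLinearMap.id ℝ E - fderiv ℝ f x).det ∂μ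
      = ∫ x in closedBall 0 ρ, η x ∂μ := by
  have := FiniteDimensional.complete ℝ E
  have hbij := bijOn_closedBall_id_sub hK hfK hsupp
  have h := integral_image_eq_integral_abs_det_fderiv_smul μ
    (measurableSet_closedBall (x := (0 : E)) (ε := ρ))
    (f' := fun x => ContinuousLinearMap.id ℝ E - fderiv ℝ f x)
    (fun x _ => ((hasFDerivAt_id x).sub
      (hf.differentiable one_ne_zero x).hasFDerivAt).hasFDerivWithinAt) hbij.injOn η
  have h' : (fun x => x - f x) '' closedBall 0 ρ = closedBall 0 ρ := hbij.image_eq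
  change ∫ x in (fun x => x - f x) '' closedBall 0 ρ, η x ∂μ = _ at h
  rw [h'] at h
  rw [h]
  refine integral_congr_ae (Eventually.of_forall fun x => ?_)
  have hpos := det_one_sub_pos (fderiv ℝ f x)
    ((norm_fderiv_le_of_lipschitz ℝ hfK).trans_lt (by exact_mod_cast hK))
  change _ = |(ContinuousLinearMap.id ℝ E - fderiv ℝ f x).det| * η (x - f x)
  rw [abs_of_pos hpos, mul_comm]

variable [InnerProductSpace ℝ E] [FiniteDimensional ℝ E]

/-- Here f need not be a contraction. With sf in place of f the identity holds for 0 ≤ s ≤ 1/(K +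
1), K a Lipschitz constant. In an inner product space ‖x - s f x‖² is quadratic in s, so the
integrand is a polynomial of degree at most 2k + dim E and the identity extends to s = 1. -/
lemma integral_pow_mul_det_eq [MeasurableSpace E] [BorelSpace E]
    (μ : Measure E) [μ.IsAddHaarMeasure] {f : E → E} (hf : ContDiff ℝ 1 f) {ρ : ℝ}
    (hsupp : ∀ x, x ∉ closedBall 0 ρ → f x = 0) (r : ℝ) (k : ℕ) :
    ∫ x in closedBall 0 ρ, (1 - r * ‖x - f x‖ ^ 2) ^ k *
        (ContinuousLinearMap.id ℝ E - fderiv ℝ f x).det ∂μ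
      = ∫ x in closedBall 0 ρ, (1 - r * ‖x‖ ^ 2) ^ k ∂μ := by
  have hcs : HasCompactSupport f :=
    HasCompactSupport.intro (isCompact_closedBall 0 ρ) hsupp
  obtain ⟨K, hK⟩ := hf.lipschitzWith_of_hasCompactSupport hcs one_ne_zero
  let h : E → ℝ → ℝ := fun x s => (1 - r * ‖x - s • f x‖ ^ 2) ^ k *
    (ContinuousLinearMap.id ℝ E - s • fderiv ℝ f x).det
  have hdet : ∀ s : ℝ, Continuous fun x => (ContinuousLinearMap.id ℝ E - s • fderiv ℝ f x).det := by
    intro s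
    have := hf.continuous_fderiv one_ne_zero
    exact ContinuousLinearMap.continuous_det.comp (by fun_prop)
  have hcont : ∀ s, Continuous fun x => h x s := by
    intro s
    have := hf.continuous
    exact Continuous.mul (by fun_prop) (hdet s)
  have key := integral_eq_of_polynomial_of_eqOn (μ := μ.restrict (closedBall 0 ρ)) h
    (2 * k + Module.finrank ℝ E) (ε := 1 / (K + 1))
    (c := ∫ x in closedBall 0 ρ, (1 - r * ‖x‖ ^ 2) ^ k ∂μ) (by positivity) ?_ ?_ ?_ 1
  · simpa only [h, one_smul] using key
  · intro x
    obtain ⟨q, hq, hqe⟩ := exists_polynomial_det_one_sub_smul (fderiv ℝ f x)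
    refine ⟨(C (-r * ‖f x‖ ^ 2) * X ^ 2 + C (2 * r * inner ℝ x (f x)) * X
      + C (1 - r * ‖x‖ ^ 2)) ^ k * q, ?_, fun s => ?_⟩
    · refine natDegree_mul_le.trans (add_le_add ?_ hq)
      refine natDegree_pow_le.trans ?_
      rw [mul_comm]
      exact Nat.mul_le_mul_right _ natDegree_quadratic_le
    · simp only [h, eval_mul, eval_pow, eval_add, eval_C, eval_X, hqe]
      congr 2
      rw [norm_sub_sq_real, norm_smul, inner_smul_right, mul_pow, Real.norm_eq_abs, sq_abs]
      ring
  · intro s _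
    exact ((hcont s).continuousOn.integrableOn_compact (isCompact_closedBall 0 ρ))
  · intro s hs
    have hsK : s.toNNReal * K < 1 := by
      rw [← NNReal.coe_lt_coe, NNReal.coe_mul, Real.coe_toNNReal s hs.1]
      have hK0 : (0 : ℝ) ≤ K := K.2
      calc s * K ≤ 1 / (K + 1) * K := mul_le_mul_of_nonneg_right hs.2 hK0
        _ < 1 := by rw [div_mul_eq_mul_div, one_mul, div_lt_one (by positivity)]; linarith
    have hlip : LipschitzWith (s.toNNReal * K) fun x => s • f x := by
      refine LipschitzWith.of_dist_le_mul fun x y => ?_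
      rw [dist_smul₀, NNReal.coe_mul, Real.coe_toNNReal s hs.1, Real.norm_of_nonneg hs.1, mul_assoc]
      exact mul_le_mul_of_nonneg_left (hK.dist_le_mul x y) hs.1
    have := integral_closedBall_eq_integral_det μ (hf.const_smul s) hsK hlip
      (ρ := ρ) (fun x hx => by rw [hsupp x hx, smul_zero]) (fun y => (1 - r * ‖y‖ ^ 2) ^ k)
    rw [← this]
    refine integral_congr_ae (Eventually.of_forall fun x => ?_)
    simp only [h]
    rw [fderiv_fun_const_smul (hf.differentiable one_ne_zero x)]

/-- If ‖x - f x‖ ≥ δ throughout, the left side of `integral_pow_mul_det_eq` is O(aᵏ), while the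
right side is at least a positive multiple of bᵏ with b > a; k → ∞ is a contradiction. -/
lemma exists_norm_sub_lt_of_contDiff {f : E → E} (hf : ContDiff ℝ 1 f) {ρ : ℝ} (hρ : 0 < ρ)
    (hsupp : ∀ x, x ∉ closedBall 0 ρ → f x = 0) {δ : ℝ} (hδ : 0 < δ) :
    ∃ x, ‖x - f x‖ < δ := by
  borelize E
  by_contra! hcon
  let μ : Measure E := Measure.addHaar
  have hcs : HasCompactSupport f :=
    HasCompactSupport.intro (isCompact_closedBall 0 ρ) hsupp
  obtain ⟨C, hC⟩ := hcs.exists_bound_of_continuous hf.continuous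
  have hC0 : 0 ≤ C := (norm_nonneg _).trans (hC 0)
  -- R bounds both ‖x‖ and ‖x - f x‖ on the ball, so with r = R⁻² the weight 1 - r t² is nonnegative
  -- at both.
  set R := ρ + C with hR
  have hRpos : 0 < R := by positivity
  set r := (R ^ 2)⁻¹ with hr
  have hrpos : 0 < r := by positivity
  have hrR : r * R ^ 2 = 1 := inv_mul_cancel₀ (by positivity)
  -- δ' < δ gives a < b, and δ' ≤ ρ keeps the small ball inside the domain of integration.
  set δ' := min (δ / 2) ρ with hδ'
  have hδ'pos : 0 < δ' := lt_min (by positivity) hρ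
  have hδ'δ : δ' < δ := (min_le_left _ _).trans_lt (by linarith)
  set a := 1 - r * δ ^ 2 with ha
  set b := 1 - r * δ' ^ 2 with hb
  have hab : a < b := by
    have : δ' ^ 2 < δ ^ 2 := by gcongr
    rw [ha, hb]; nlinarith
  have hle : ∀ t, 0 ≤ t → t ≤ R → 0 ≤ 1 - r * t ^ 2 := by
    intro t ht htR
    rw [← hrR, ← mul_sub]
    exact mul_nonneg hrpos.le (sub_nonneg.2 (by gcongr))
  have hFR : ∀ x ∈ closedBall (0 : E) ρ, ‖x - f x‖ ≤ R := fun x hx =>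
    (norm_sub_le _ _).trans (add_le_add (mem_closedBall_zero_iff.1 hx) (hC x))
  have ha0 : 0 ≤ a := by
    have h0 : (0 : E) ∈ closedBall (0 : E) ρ := by simp [hρ.le]
    exact hle δ hδ.le ((hcon 0).trans (hFR 0 h0))
  have hb0 : 0 < b := ha0.trans_lt hab
  let J : E → ℝ := fun x => (ContinuousLinearMap.id ℝ E - fderiv ℝ f x).det
  have hJ : Continuous J := by
    have := hf.continuous_fderiv one_ne_zero
    exact ContinuousLinearMap.continuous_det.comp (by fun_prop)
  have hfc := hf.continuous
  have hInt : ∀ {φ : E → ℝ}, Continuous φ → IntegrableOn φ (closedBall 0 ρ) μ := fun h =>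
    h.continuousOn.integrableOn_compact (isCompact_closedBall 0 ρ)
  have hupper : ∀ k : ℕ, ∫ x in closedBall 0 ρ, (1 - r * ‖x - f x‖ ^ 2) ^ k * J x ∂μ
      ≤ a ^ k * ∫ x in closedBall 0 ρ, |J x| ∂μ := by
    intro k
    rw [← integral_const_mul]
    refine setIntegral_mono_on (hInt (by fun_prop)) (hInt (by fun_prop))
      measurableSet_closedBall fun x hx => ?_
    have h1 := hle _ (norm_nonneg _) (hFR x hx)
    have h2 : 1 - r * ‖x - f x‖ ^ 2 ≤ a := by
      have := hcon x
      rw [ha]; gcongr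
    calc (1 - r * ‖x - f x‖ ^ 2) ^ k * J x ≤ (1 - r * ‖x - f x‖ ^ 2) ^ k * |J x| := by
          gcongr; exact le_abs_self _
      _ ≤ a ^ k * |J x| := by gcongr
  have hlower : ∀ k : ℕ, μ.real (closedBall 0 δ') * b ^ k
      ≤ ∫ x in closedBall 0 ρ, (1 - r * ‖x‖ ^ 2) ^ k ∂μ := by
    intro k
    have hsub : closedBall (0 : E) δ' ⊆ closedBall 0 ρ := closedBall_subset_closedBall (min_le_right _ _)
    calc μ.real (closedBall 0 δ') * b ^ k = ∫ _ in closedBall (0 : E) δ', b ^ k ∂μ := by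
          rw [setIntegral_const, smul_eq_mul]
      _ ≤ ∫ x in closedBall 0 δ', (1 - r * ‖x‖ ^ 2) ^ k ∂μ := by
          refine setIntegral_mono_on (integrableOn_const measure_closedBall_lt_top.ne)
            ((hInt (by fun_prop)).mono_set hsub) measurableSet_closedBall fun x hx => ?_
          have hx' := mem_closedBall_zero_iff.1 hx
          rw [hb]; gcongr
      _ ≤ ∫ x in closedBall 0 ρ, (1 - r * ‖x‖ ^ 2) ^ k ∂μ := by
          refine setIntegral_mono_set (hInt (by fun_prop)) ?_ hsub.eventuallyLE
          refine (ae_restrict_iff' measurableSet_closedBall).2 (Eventually.of_forall fun x hx => ?_)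
          exact pow_nonneg (hle _ (norm_nonneg _)
            ((mem_closedBall_zero_iff.1 hx).trans (by linarith))) k
  have hvol : 0 < μ.real (closedBall (0 : E) δ') :=
    ENNReal.toReal_pos (measure_closedBall_pos μ 0 hδ'pos).ne' measure_closedBall_lt_top.ne
  have hall : ∀ k : ℕ, μ.real (closedBall (0 : E) δ') ≤
      (a / b) ^ k * ∫ x in closedBall 0 ρ, |J x| ∂μ := by
    intro k
    have h1 := (hlower k).trans
      ((integral_pow_mul_det_eq μ hf hsupp r k).symm.le.trans (hupper k))
    rw [div_pow, div_mul_eq_mul_div, le_div_iff₀ (by positivity)]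
    exact h1
  have hlim : Tendsto (fun k : ℕ => (a / b) ^ k * ∫ x in closedBall 0 ρ, |J x| ∂μ) atTop (𝓝 0) := by
    simpa using (tendsto_pow_atTop_nhds_zero_of_lt_one (div_nonneg ha0 hb0.le)
      ((div_lt_one hb0).2 hab)).mul_const (∫ x in closedBall 0 ρ, |J x| ∂μ)
  exact hvol.not_ge (ge_of_tendsto' hlim hall)

/-- A cutoff makes f compactly supported, smooth approximations then give approximate fixed points,
and compactness gives an exact one. It has norm at most C, where the cutoff equals 1. -/
lemma exists_fixedPoint_of_bounded_of_innerProductSpace {f : E → E} (hf : Continuous f) {C : ℝ}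
    (hC : ∀ x, ‖f x‖ ≤ C) : ∃ x, f x = x := by
  have hC0 : 0 ≤ C := (norm_nonneg _).trans (hC 0)
  let φ : ContDiffBump (0 : E) := ⟨C + 1, C + 2, by positivity, by linarith⟩
  let f' : E → E := fun x => φ x • f x
  have hf' : Continuous f' := φ.continuous.smul hf
  have hsupp : ∀ x, x ∉ closedBall (0 : E) (C + 2) → f' x = 0 := by
    intro x hx
    have : φ x = 0 := φ.zero_of_le_dist (not_le.1 (mt mem_closedBall.2 hx)).le
    simp only [f', this, zero_smul]
  have hnorm : ∀ x, ‖f' x‖ ≤ C := by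
    intro x
    rw [norm_smul, Real.norm_of_nonneg φ.nonneg]
    exact (mul_le_of_le_one_left (norm_nonneg _) φ.le_one).trans (hC x)
  have happrox : ∀ δ > 0, ∃ x, ‖x - f' x‖ < δ := by
    intro δ hδ
    obtain ⟨g, hg, hgf, hgs⟩ := hf'.exists_contDiff_approx 1 (ε := fun _ => δ / 2)
      continuous_const (fun _ => by positivity)
    obtain ⟨x, hx⟩ := exists_norm_sub_lt_of_contDiff hg (ρ := C + 2) (by positivity)
      (fun x hx => by
        by_contra hne
        exact hgs hne (hsupp x hx)) (half_pos hδ)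
    refine ⟨x, ?_⟩
    have h2 := hgf x
    rw [dist_eq_norm] at h2
    calc ‖x - f' x‖ = ‖(x - g x) + (g x - f' x)‖ := by congr 1; abel
      _ ≤ ‖x - g x‖ + ‖g x - f' x‖ := norm_add_le _ _
      _ < δ := by linarith
  obtain ⟨x, -, hx⟩ := (isCompact_closedBall (0 : E) (C + 1)).exists_isMinOn
    ⟨0, by simp; positivity⟩ (f := fun x => ‖x - f' x‖) (by fun_prop)
  have hx0 : x = f' x := by
    by_contra hne
    have hpos : 0 < ‖x - f' x‖ := norm_pos_iff.2 (sub_ne_zero.2 hne)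
    -- The bound 1 keeps z in the ball of radius C + 1 on which x is a minimizer.
    obtain ⟨z, hz⟩ := happrox (min 1 ‖x - f' x‖) (lt_min one_pos hpos)
    have hz1 : z ∈ closedBall (0 : E) (C + 1) := by
      rw [mem_closedBall_zero_iff]
      calc ‖z‖ = ‖f' z + (z - f' z)‖ := by congr 1; abel
        _ ≤ ‖f' z‖ + ‖z - f' z‖ := norm_add_le _ _
        _ ≤ C + 1 := add_le_add (hnorm z) (hz.le.trans (min_le_left _ _))
    exact (hz.trans_le (min_le_right _ _)).not_ge (hx hz1)
  have hφ : φ x = 1 := by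
    refine φ.one_of_mem_closedBall (mem_closedBall_zero_iff.2 ?_)
    rw [hx0]
    exact (hnorm x).trans (by change C ≤ C + 1; linarith)
  refine ⟨x, ?_⟩
  conv_rhs => rw [hx0]
  simp only [f', hφ, one_smul]

/-- **Brouwer's fixed point theorem**, for bounded continuous self-maps of a finite-dimensional
normed space. -/
theorem exists_fixedPoint_of_bounded {F : Type*} [NormedAddCommGroup F] [NormedSpace ℝ F]
    [FiniteDimensional ℝ F] {f : F → F} (hf : Continuous f) {C : ℝ} (hC : ∀ x, ‖f x‖ ≤ C) :
    ∃ x, f x = x := by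
  let e : F ≃L[ℝ] EuclideanSpace ℝ (Fin (Module.finrank ℝ F)) :=
    ContinuousLinearEquiv.ofFinrankEq (by simp)
  obtain ⟨x, hx⟩ := exists_fixedPoint_of_bounded_of_innerProductSpace
    (f := fun x => e (f (e.symm x))) (by fun_prop)
    (C := ‖(e : F →L[ℝ] EuclideanSpace ℝ (Fin (Module.finrank ℝ F)))‖ * C) fun x =>
      ((e : F →L[ℝ] EuclideanSpace ℝ (Fin (Module.finrank ℝ F))).le_opNorm _).trans
        (mul_le_mul_of_nonneg_left (hC _) (norm_nonneg _))
  exact ⟨e.symm x, e.injective (hx.trans (e.apply_symm_apply x).symm)⟩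

end Brouwer

/-! ### From the first order system back to the scalar equation. -/

namespace MultipointBVP

open Matrix

lemma act_apply {n : ℕ} (M : Matrix (Fin n) (Fin n) ℝ) (x : E n) (i : Fin n) :
    act M x i = ∑ j, M i j * x j := by
  simp [act, Matrix.toLpLin_apply, Matrix.mulVec, dotProduct]

/-- A solution of the first order system gives a solution of the scalar problem of order `n`. -/
lemma exists_scalar_solution {n N : ℕ} [NeZero n] (a : ℕ → Fin n → ℝ)
    (B : ℕ → Matrix (Fin n) (Fin n) ℝ) (x : ℕ → E n) (γ : ℕ → ℝ)
    (hx : ∀ t < N, x (t + 1) = act (companion a t) (x t)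
      + γ t • EuclideanSpace.single (lastIdx n) (1 : ℝ))
    (hB : ∑ k ∈ Finset.range (N + 1), act (B k) (x k) = 0) :
    ∃ y : ℕ → ℝ, (∀ t ≤ N, ∀ j : Fin n, y (t + j) = x t j) ∧
      (∀ t < N, y (t + n) + ∑ j : Fin n, a t j * y (t + j) = γ t) ∧
      (∀ i : Fin n, ∑ k ∈ Finset.range (N + 1), ∑ j : Fin n, B k i j * y (k + j) = 0) := by
  have hn : n - 1 + 1 = n := Nat.sub_add_cancel (Nat.pos_of_ne_zero (NeZero.ne n))
  have hshift : ∀ t < N, ∀ (j : ℕ) (hj : j + 1 < n),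
      x (t + 1) ⟨j, by omega⟩ = x t ⟨j + 1, hj⟩ := by
    intro t ht j hj
    rw [hx t ht, PiLp.add_apply, act_apply, Finset.sum_eq_single ⟨j + 1, hj⟩]
    · have h1 : j + 1 ≠ n := by omega
      have h2 : j ≠ n - 1 := by omega
      simp [companion, h1, h2, lastIdx]
    · intro b _ hb
      have h1 : j + 1 ≠ n := by omega
      have h2 : b.val ≠ j + 1 := fun h => hb (Fin.ext h)
      simp [companion, h1, h2]
    · simp
  -- The values y(N), …, y(N + n - 1) are the coordinates of x(N); the final 0 is never used.
  let y : ℕ → ℝ := fun k =>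
    if k ≤ N then x k 0 else if h : k - N < n then x N ⟨k - N, h⟩ else 0
  have hy : ∀ (j : ℕ) (hj : j < n), ∀ t ≤ N, y (t + j) = x t ⟨j, hj⟩ := by
    intro j
    induction j with
    | zero =>
      intro hj t ht
      simp only [y, add_zero, if_pos ht]
      rfl
    | succ j ih =>
      intro hj t ht
      -- For t < N the companion form trades one index for one time step; at t = N no equation is
      -- available and the definition of y applies.
      rcases ht.lt_or_eq with ht | rfl
      · rw [← hshift t ht j hj, ← ih (by omega) (t + 1) ht]
        congr 1
        omega
      · have h1 : ¬ (t + (j + 1) ≤ t) := by omega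
        simp only [y, if_neg h1, Nat.add_sub_cancel_left, dif_pos hj]
  have hy' : ∀ t ≤ N, ∀ j : Fin n, y (t + j) = x t j := fun t ht j => hy j j.2 t ht
  refine ⟨y, hy', fun t ht => ?_, fun i => ?_⟩
  · have h1 : y (t + n) = x (t + 1) (lastIdx n) := by
      rw [← hy' (t + 1) ht]
      congr 1
      simp only [lastIdx]
      omega
    simp only [hy' t ht.le]
    rw [h1, hx t ht, PiLp.add_apply, act_apply]
    simp [companion, lastIdx, hn]
  · have h1 := congrArg (fun z : E n => z i) hB
    simp only [WithLp.ofLp_sum, Finset.sum_apply, act_apply, PiLp.zero_apply] at h1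
    rw [← h1]
    refine Finset.sum_congr rfl fun k hk => Finset.sum_congr rfl fun j _ => ?_
    rw [hy' k (Nat.lt_succ_iff.1 (Finset.mem_range.1 hk))]

end MultipointBVP

/-! ### Bounds for g, and a scalar equation coupled with a fixed point equation. -/

lemma abs_le_supNormOn {N : ℕ} {g : ℝ × ℝ → ℝ} (hg : Continuous g) {r : ℝ} {t : ℕ} (ht : t < N)
    {x : ℝ} (hx : x ∈ Set.Icc (-r) r) : |g ((t : ℝ), x)| ≤ supNormOn N g r := by
  refine le_csSup ?_ ⟨t, ht, x, hx, rfl⟩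
  have hK : IsCompact (((fun t : ℕ => (t : ℝ)) '' Set.Iio N) ×ˢ Set.Icc (-r) r) :=
    ((Set.finite_Iio N).image _).isCompact.prod isCompact_Icc
  refine (hK.bddAbove_image (f := fun z => |g z|) (by fun_prop)).mono ?_
  rintro v ⟨t, ht, x, hx, rfl⟩
  exact ⟨((t : ℝ), x), ⟨⟨t, ht, rfl⟩, hx⟩, rfl⟩

/-- A continuous `G : ℝ × X → ℝ` that changes sign between `-r` and `r`, and a bounded continuous
`M : ℝ × X → X`, admit a common solution of `G(α, v) = 0` and `v = M(α, v)`. -/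
lemma exists_zero_and_fixedPoint {X : Type*} [NormedAddCommGroup X] [NormedSpace ℝ X]
    [FiniteDimensional ℝ X] {r R : ℝ} (hr : 0 < r) {G : ℝ × X → ℝ} (hG : Continuous G)
    {M : ℝ × X → X} (hM : Continuous M) (hMR : ∀ z, ‖M z‖ ≤ R)
    (hpos : ∀ v, ‖v‖ ≤ R → 0 < G (r, v)) (hneg : ∀ v, ‖v‖ ≤ R → G (-r, v) < 0) :
    ∃ α ∈ Set.Icc (-r) r, ∃ v, ‖v‖ ≤ R ∧ G (α, v) = 0 ∧ M (α, v) = v := by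
  let cl : ℝ → ℝ := fun α => max (-r) (min r α)
  have hcl : ∀ α, cl α ∈ Set.Icc (-r) r := fun α =>
    ⟨le_max_left _ _, max_le (by linarith) (min_le_left _ _)⟩
  have hcl' : ∀ α ∈ Set.Icc (-r) r, cl α = α := fun α h => by
    simp only [cl]; rw [min_eq_right h.2, max_eq_right h.1]
  have hcont : Continuous cl := by fun_prop
  -- At a fixed point α is the clamp of α - G(α, v). Thus G < 0 forces α = r and G > 0 forces α =
  -- -r, both excluded by the boundary signs.
  obtain ⟨⟨α, v⟩, hT⟩ := exists_fixedPoint_of_bounded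
    (f := fun z : ℝ × X => (cl (cl z.1 - G (cl z.1, z.2)), M (cl z.1, z.2)))
    (by fun_prop) (C := max r R) fun z => by
      rw [Prod.norm_mk]
      exact max_le_max (abs_le.2 (hcl _)) (hMR _)
  obtain ⟨h1, h2⟩ := Prod.mk.inj hT
  have hα : α ∈ Set.Icc (-r) r := h1 ▸ hcl _
  simp only [hcl' α hα] at h1 h2
  have hv : ‖v‖ ≤ R := h2 ▸ hMR _
  refine ⟨α, hα, v, hv, ?_, h2⟩
  simp only [cl] at h1
  rcases lt_trichotomy (G (α, v)) 0 with h | h | h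
  · have h3 : α = r := by
      by_contra hne
      have h4 : α < r := lt_of_le_of_ne hα.2 hne
      have h5 : α < min r (α - G (α, v)) := lt_min h4 (by linarith)
      exact (h5.trans_le (le_max_right (-r) _)).ne' h1
    have := hpos v hv
    rw [h3] at h
    linarith
  · exact h
  · have h3 : α = -r := by
      by_contra hne
      have h4 : -r < α := lt_of_le_of_ne hα.1 (Ne.symm hne)
      have h5 : max (-r) (min r (α - G (α, v))) < α :=
        max_lt h4 ((min_le_right _ _).trans_lt (by linarith))
      exact h5.ne h1
    have := hneg v hv
    rw [h3] at h
    linarith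

/-! ### Properties of S, Ψ and M_p(I - Q) used in the reduction. -/

namespace ResonantBVP

open Matrix MultipointBVP

variable {n N : ℕ} [NeZero n] (p : ResonantBVP n N)

lemma boundary_u : act (boundaryMatrix N p.a p.B) p.u = 0 :=
  LinearMap.mem_ker.1 (p.span_u ▸ Submodule.mem_span_singleton_self p.u)

/-- `S` as an element of `X`. -/
noncomputable def SX : spaceX N p.B :=
  ⟨fun t => p.S t, by
    change ∑ k : Fin (N + 1), act (p.B k) (act (fundamental p.a k) p.u) = 0
    rw [sum_boundary, boundary_u]⟩

lemma L_SX : p.L p.SX = 0 := by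
  funext t
  rw [L_apply]
  simp only [SX, S, Fin.val_succ, Fin.val_castSucc, fundamental, act_mul, sub_self, Pi.zero_apply]

lemma L_MpOneSubQ (h : spaceZ n N) : p.L (p.MpOneSubQ h) = h - p.Q h :=
  congrArg Subtype.val
    ((LinearEquiv.ofBijective p.LRestr p.LRestr_bijective).apply_symm_apply (p.oneSubQ h))

lemma Q_eq_zero {h : spaceZ n N} (hh : p.psiSum h = 0) : p.Q h = 0 := by
  funext t
  change ((∑ j : Fin N, ‖p.Psi j‖ ^ 2)⁻¹ * p.psiSum h) • p.Psi t = 0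
  rw [hh, mul_zero, zero_smul]

lemma norm_MpOneSubQ_le (h : spaceZ n N) : ‖p.MpOneSubQ h‖ ≤ p.opNormA * ‖h‖ :=
  (LinearMap.toContinuousLinearMap p.MpOneSubQ).le_opNorm h

lemma opNormA_nonneg : 0 ≤ p.opNormA :=
  norm_nonneg (LinearMap.toContinuousLinearMap p.MpOneSubQ)

lemma psiSum_smul_single (γ : Fin N → ℝ) :
    p.psiSum (fun t => γ t • EuclideanSpace.single (lastIdx n) (1 : ℝ))
      = ∑ t : Fin N, p.Psi t (lastIdx n) * γ t := by
  change ∑ t : Fin N, inner ℝ (p.Psi t) (γ t • EuclideanSpace.single (lastIdx n) (1 : ℝ)) = _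
  refine Finset.sum_congr rfl fun t _ => ?_
  rw [inner_smul_right, EuclideanSpace.inner_single_right]
  simp [mul_comm]

lemma mem_O_iff (m : Fin n) (t : Fin N) :
    t ∈ p.O m ↔ p.Psi t (lastIdx n) ≠ 0 ∧ p.S t m ≠ 0 := by
  simp only [O, Opp, Opm, Omp, Omm, Set.mem_union, Set.mem_ofPred_eq]
  constructor
  · rintro (((h | h) | h) | h)
    exacts [⟨h.1.ne', h.2.ne'⟩, ⟨h.1.ne', h.2.ne⟩, ⟨h.1.ne, h.2.ne'⟩, ⟨h.1.ne, h.2.ne⟩]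
  · rintro ⟨h1, h2⟩
    rcases lt_or_gt_of_ne h1 with h1 | h1 <;> rcases lt_or_gt_of_ne h2 with h2 | h2 <;> simp [h1, h2]

lemma abs_S_le_smax (m : Fin n) (t : Fin N) : |p.S t m| ≤ p.smax m :=
  le_csSup (Set.finite_range _).bddAbove ⟨t, rfl⟩

lemma smin_le_abs_S {m : Fin n} {t : Fin N} (ht : t ∈ p.O m) : p.smin m ≤ |p.S t m| :=
  csInf_le (Set.toFinite _).bddBelow ⟨t, ht, rfl⟩

lemma smin_pos {m : Fin n} (h : (p.O m).Nonempty) : 0 < p.smin m := by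
  obtain ⟨t, ht, hts⟩ := (h.image fun t : Fin N => |p.S t m|).csInf_mem (Set.toFinite _)
  rw [smin, ← hts]
  exact abs_pos.2 ((p.mem_O_iff m t).1 ht).2

lemma exists_scalar_solution_of_L_eq {x : spaceX N p.B} {m : Fin n} {g : ℝ × ℝ → ℝ}
    (hx : ∀ t : Fin N, p.L x t = g ((t : ℕ), x.1 t.castSucc m) •
      EuclideanSpace.single (lastIdx n) (1 : ℝ)) :
    ∃ y : ℕ → ℝ,
      (∀ t < N, y (t + n) + ∑ j : Fin n, p.a t j * y (t + j) = g ((t : ℝ), y (t + m))) ∧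
      (∀ i : Fin n, ∑ k ∈ Finset.range (N + 1), ∑ j : Fin n, p.B k i j * y (k + j) = 0) := by
  let x' : ℕ → E n := fun t => if ht : t < N + 1 then x.1 ⟨t, ht⟩ else 0
  have hx' : ∀ (t : ℕ) (ht : t < N + 1), x' t = x.1 ⟨t, ht⟩ := fun t ht => dif_pos ht
  have hx1 : ∀ t < N, x' (t + 1) = act (companion p.a t) (x' t)
      + g ((t : ℝ), x' t m) • EuclideanSpace.single (lastIdx n) (1 : ℝ) := by
    intro t ht
    have h := hx ⟨t, ht⟩
    rw [L_apply, sub_eq_iff_eq_add'] at h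
    rw [hx' (t + 1) (by omega), hx' t (by omega)]
    exact h
  have hx2 : ∑ k ∈ Finset.range (N + 1), act (p.B k) (x' k) = 0 := by
    have h := x.2
    change ∑ k : Fin (N + 1), act (p.B k) (x.1 k) = 0 at h
    rw [Finset.sum_range, ← h]
    exact Finset.sum_congr rfl fun k _ => by rw [hx' k k.2]
  obtain ⟨y, hy, hy1, hy2⟩ := exists_scalar_solution p.a p.B x' _ hx1 hx2
  refine ⟨y, fun t ht => ?_, hy2⟩
  rw [hy t ht.le m]
  exact hy1 t ht

end ResonantBVP

/-! ### The existence theorem. -/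

lemma exists_sign_of_or {ι : Type*} {P : ι → Prop} {f : ι → ℝ}
    (h : (∀ t, P t → 0 ≤ f t) ∨ ∀ t, P t → f t ≤ 0) :
    ∃ σ : ℝ, (σ = 1 ∨ σ = -1) ∧ ∀ t, P t → 0 ≤ σ * f t := by
  rcases h with h | h
  · exact ⟨1, Or.inl rfl, fun t ht => by simpa using h t ht⟩
  · exact ⟨-1, Or.inr rfl, fun t ht => by simpa using h t ht⟩

theorem corollary3p3 {n N : ℕ} [NeZero n] (hN : 2 < N) (p : ResonantBVP n N) (m : Fin n)
    (g : ℝ × ℝ → ℝ) (hg : Continuous g)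
    (hO_zero : p.Ozero m = ∅) (hO_nonempty : (p.O m).Nonempty)
    (hsign : (∀ t < N, 0 ≤ p.Psi t (MultipointBVP.lastIdx n) * p.S t m) ∨
      (∀ t < N, p.Psi t (MultipointBVP.lastIdx n) * p.S t m ≤ 0))
    (c d : ℝ) (hc : 0 < c) (hcd : c < d)
    (hg_sign :
      (∀ t < N, (∀ x ∈ Set.Icc c d, 0 < g ((t : ℝ), x)) ∧
        (∀ x ∈ Set.Icc (-d) (-c), g ((t : ℝ), x) < 0)) ∨
      (∀ t < N, (∀ x ∈ Set.Icc c d, g ((t : ℝ), x) < 0) ∧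
        (∀ x ∈ Set.Icc (-d) (-c), 0 < g ((t : ℝ), x))))
    (hgrowth : d >
      (c * p.smax m + p.opNormA * supNormOn N g d * (p.smax m + p.smin m)) / p.smin m) :
    ∃ y : ℕ → ℝ,
      (∀ t < N, y (t + n) + ∑ j : Fin n, p.a t j * y (t + j) = g ((t : ℝ), y (t + m))) ∧
      (∀ i : Fin n, ∑ k ∈ Finset.range (N + 1), ∑ j : Fin n, p.B k i j * y (k + j) = 0) := by
  have hd : 0 < d := hc.trans hcd
  have hs := p.smin_pos hO_nonempty
  have hnorm0 : 0 ≤ supNormOn N g d :=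
    (abs_nonneg _).trans (abs_le_supNormOn hg (show 0 < N by omega)
      (show (0 : ℝ) ∈ Set.Icc (-d) d from ⟨by linarith, hd.le⟩))
  have hA0 : 0 ≤ p.opNormA := p.opNormA_nonneg
  set R := p.opNormA * supNormOn N g d with hR
  have hR0 : 0 ≤ R := mul_nonneg hA0 hnorm0
  -- Chosen so that r s_min - R = c; the growth condition then gives r s_max + R ≤ d.
  set r := (c + R) / p.smin m with hr
  have hr0 : 0 < r := by positivity
  have hrmin : r * p.smin m = c + R := div_mul_cancel₀ _ hs.ne'
  have hrmax : r * p.smax m + R ≤ d := by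
    refine le_of_eq_of_le ?_ hgrowth.le
    rw [hr]; field_simp; ring
  -- The signs σ and τ merge the four combinations of sign hypotheses into one argument.
  obtain ⟨σ, hσ, hσs⟩ := exists_sign_of_or hsign
  obtain ⟨τ, hτ, hτg⟩ : ∃ τ : ℝ, (τ = 1 ∨ τ = -1) ∧ ∀ t < N,
      (∀ x ∈ Set.Icc c d, 0 < τ * g ((t : ℝ), x)) ∧
      (∀ x ∈ Set.Icc (-d) (-c), τ * g ((t : ℝ), x) < 0) := by
    rcases hg_sign with h | h
    · exact ⟨1, Or.inl rfl, by simpa using h⟩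
    · exact ⟨-1, Or.inr rfl, by simpa using h⟩
  -- Clamping makes the nonlinearity bounded by ‖g‖_d on all of ℝ × X, as Brouwer's theorem
  -- requires.
  let cl : ℝ → ℝ := fun x => max (-d) (min d x)
  have hcl : ∀ x, cl x ∈ Set.Icc (-d) d := fun x =>
    ⟨le_max_left _ _, max_le (by linarith) (min_le_left _ _)⟩
  have hcl' : ∀ x ∈ Set.Icc (-d) d, cl x = x := fun x h => by
    simp only [cl]; rw [min_eq_right h.2, max_eq_right h.1]
  let X := MultipointBVP.spaceX N p.B
  let γ : ℝ × X → Fin N → ℝ := fun z t =>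
    g (((t : ℕ) : ℝ), cl (z.1 * p.S t m + z.2.1 t.castSucc m))
  let e : MultipointBVP.E n := EuclideanSpace.single (MultipointBVP.lastIdx n) (1 : ℝ)
  let h : ℝ × X → MultipointBVP.spaceZ n N := fun z t => γ z t • e
  have hγ : ∀ t, Continuous fun z => γ z t := fun t => by
    have hcoord : Continuous fun z : ℝ × X => z.2.1 t.castSucc m :=
      (EuclideanSpace.proj (𝕜 := ℝ) m).continuous.comp
        ((continuous_apply t.castSucc).comp (continuous_subtype_val.comp continuous_snd))
    have hclc : Continuous cl := by fun_prop
    exact hg.comp (continuous_const.prodMk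
      (hclc.comp ((continuous_fst.mul continuous_const).add hcoord)))
  have hh : Continuous h := continuous_pi fun t => (hγ t).smul continuous_const
  have hhR : ∀ z, ‖p.MpOneSubQ (h z)‖ ≤ R := fun z => by
    refine (p.norm_MpOneSubQ_le _).trans (mul_le_mul_of_nonneg_left ?_ hA0)
    refine (pi_norm_le_iff_of_nonneg hnorm0).2 fun t => ?_
    have he : ‖e‖ = 1 := by simp [e]
    rw [norm_smul, he, mul_one]
    exact abs_le_supNormOn hg t.2 (hcl _)
  have hcoord : ∀ v : X, ‖v‖ ≤ R → ∀ t : Fin N, |v.1 t.castSucc m| ≤ R := fun v hv t =>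
    ((PiLp.norm_apply_le (v.1 t.castSucc) m).trans (norm_le_pi_norm v.1 _)).trans hv
  -- the sign of a single summand at `±r`
  have hterm : ∀ v : X, ‖v‖ ≤ R → ∀ t ∈ p.O m,
      0 < σ * τ * (p.Psi t (MultipointBVP.lastIdx n) * γ (r, v) t) ∧
      σ * τ * (p.Psi t (MultipointBVP.lastIdx n) * γ (-r, v) t) < 0 := by
    intro v hv t ht
    have hS1 := mul_le_mul_of_nonneg_left (p.smin_le_abs_S ht) hr0.le
    have hS2 := mul_le_mul_of_nonneg_left (p.abs_S_le_smax m t) hr0.le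
    have hv' := abs_le.1 (hcoord v hv t)
    obtain ⟨hψ, hS⟩ := (p.mem_O_iff m t).1 ht
    have hpos : 0 < σ * (p.Psi t (MultipointBVP.lastIdx n) * p.S t m) := by
      refine lt_of_le_of_ne (hσs t t.2) (Ne.symm (mul_ne_zero ?_ (mul_ne_zero hψ hS)))
      rcases hσ with rfl | rfl <;> norm_num
    obtain ⟨hg1, hg2⟩ := hτg t t.2
    rcases lt_or_gt_of_ne hS with hS | hS
    · rw [abs_of_neg hS] at hS1 hS2
      have hσψ : σ * p.Psi t (MultipointBVP.lastIdx n) < 0 := by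
        rw [← mul_assoc] at hpos
        exact neg_of_mul_pos_left hpos hS.le
      have h1 := hg2 (cl (r * p.S t m + v.1 t.castSucc m)) (by
        rw [hcl' _ ⟨by linarith, by linarith⟩]; exact ⟨by linarith, by linarith⟩)
      have h2 := hg1 (cl (-r * p.S t m + v.1 t.castSucc m)) (by
        rw [hcl' _ ⟨by linarith, by linarith⟩]; exact ⟨by linarith, by linarith⟩)
      constructor
      · linarith [mul_pos_of_neg_of_neg hσψ h1]
      · linarith [mul_neg_of_neg_of_pos hσψ h2]
    · rw [abs_of_pos hS] at hS1 hS2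
      have hσψ : 0 < σ * p.Psi t (MultipointBVP.lastIdx n) := by
        rw [← mul_assoc] at hpos
        exact pos_of_mul_pos_left hpos hS.le
      have h1 := hg1 (cl (r * p.S t m + v.1 t.castSucc m)) (by
        rw [hcl' _ ⟨by linarith, by linarith⟩]; exact ⟨by linarith, by linarith⟩)
      have h2 := hg2 (cl (-r * p.S t m + v.1 t.castSucc m)) (by
        rw [hcl' _ ⟨by linarith, by linarith⟩]; exact ⟨by linarith, by linarith⟩)
      constructor
      · linarith [mul_pos hσψ h1]
      · linarith [mul_neg_of_pos_of_neg hσψ h2]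
  -- Emptiness of O₀ enters here: the terms whose argument of g has no controlled sign drop out.
  have hzero : ∀ t : Fin N, t ∉ p.O m → p.Psi t (MultipointBVP.lastIdx n) = 0 := by
    intro t ht
    by_contra hψ
    by_cases hS : p.S t m = 0
    · have : t ∈ p.Ozero m := ⟨hψ, hS⟩
      rw [hO_zero] at this
      exact this
    · exact ht ((p.mem_O_iff m t).2 ⟨hψ, hS⟩)
  obtain ⟨t₀, ht₀⟩ := hO_nonempty
  obtain ⟨α, hα, v, hv, hG, hM⟩ := exists_zero_and_fixedPoint (X := X) (R := R) hr0
    (G := fun z => ∑ t : Fin N, σ * τ * (p.Psi t (MultipointBVP.lastIdx n) * γ z t))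
    (M := fun z => p.MpOneSubQ (h z))
    (continuous_finsetSum _ fun t _ => continuous_const.mul (continuous_const.mul (hγ t)))
    (p.MpOneSubQ.continuous_of_finiteDimensional.comp hh) hhR
    (fun v hv => Finset.sum_pos' (fun t _ => by
        by_cases ht : t ∈ p.O m
        · exact (hterm v hv t ht).1.le
        · rw [hzero t ht, zero_mul, mul_zero]) ⟨t₀, Finset.mem_univ _, (hterm v hv t₀ ht₀).1⟩)
    (fun v hv => Finset.sum_neg' (fun t _ => by
        by_cases ht : t ∈ p.O m
        · exact (hterm v hv t ht).2.le
        · rw [hzero t ht, zero_mul, mul_zero]) ⟨t₀, Finset.mem_univ _, (hterm v hv t₀ ht₀).2⟩)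
  have hψ : p.psiSum (h (α, v)) = 0 := by
    refine (p.psiSum_smul_single (γ (α, v))).trans ?_
    rw [← Finset.mul_sum] at hG
    refine (mul_eq_zero.1 hG).resolve_left (mul_ne_zero ?_ ?_)
    · rcases hσ with rfl | rfl <;> norm_num
    · rcases hτ with rfl | rfl <;> norm_num
  -- The scalar equation makes Q vanish on h(α, v), so M_p(I - Q) is an exact right inverse there.
  have hL : p.L (α • p.SX + v) = h (α, v) := by
    rw [map_add, map_smul, p.L_SX, smul_zero, zero_add]
    conv_lhs => rw [← hM]
    rw [p.L_MpOneSubQ, p.Q_eq_zero hψ, sub_zero]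
  refine p.exists_scalar_solution_of_L_eq (x := α • p.SX + v) fun t => ?_
  rw [hL]
  have hx : (α • p.SX + v).1 t.castSucc m = α * p.S t m + v.1 t.castSucc m := rfl
  -- From |α| ≤ r and ‖v‖ ≤ R the clamp acts as the identity, at every t and not only on O.
  have hmem : α * p.S t m + v.1 t.castSucc m ∈ Set.Icc (-d) d := by
    refine abs_le.1 (((abs_add_le _ _).trans (add_le_add ?_ (hcoord v hv t))).trans hrmax)
    rw [abs_mul]
    exact mul_le_mul (abs_le.2 hα) (p.abs_S_le_smax m t) (abs_nonneg _) hr0.le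
  simp only [h, γ]
  rw [hx, hcl' _ hmem]
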